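/- Let $k$ be a field of characteristic zero and $n \ge 0$. Let $\Omega$ be the $k$-algebra (under the wedge product) of differential forms with polynomial coefficients on the space $M_n(k)$ of $n\times n$ matrices, that is, $\Omega = k[x_{ij}] \otimes_k \Lambda(M_n(k)^*)$, where $x_{ij}$ $(1\le i,j\le n)$ are the coordinate functions and $dx_{ij} \in M_n(k)^*$ is the $(i,j)$ entry functional. The group $GL_n(k)$ acts on $\Omega$ by pullback along the adjoint action $A \mapsto gAg^{-1}$ on $M_n(k)$; a form is called invariant if it is fixed by all $g\in GL_n(k)$. Put $X=(x_{ij})$ and $dX=(dx_{ij})$, and for $p\ge 1$ and $\ell_1,\dots,\ell_p\ge 0$ let $$\omega^{\ell_1\cdots\ell_p}=\mathrm{Tr}\left(X^{\ell_1}dX\wedge X^{\ell_2}dX\wedge\cdots\wedge X^{\ell_p}dX\right)=\sum_{i_1,\dots,i_p,j_1,\dots,j_p=1}^{n}(X^{\ell_1})_{i_1j_1}\,dx_{j_1i_2}\wedge(X^{\ell_2})_{i_2j_2}\,dx_{j_2i_3}\wedge\cdots\wedge(X^{\ell_p})_{i_pj_p}\,dx_{j_pi_1}.$$ Theorem. The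 $k$-algebra of $GL_n(k)$-invariant forms in $\Omega$ is generated over $k$ by the functions $\mathrm{Tr}(X^\ell)$ $(\ell\ge 1)$, which are the trace forms of degree zero, together with the forms $\omega^{\ell_1\cdots\ell_p}$ $(p\ge 1,\ \ell_1,\dots,\ell_p\ge 0)$. In other words, the invariant forms are exactly the $k$-linear combinations of (possibly empty) products of these trace forms. -/

import Mathlib

open scoped TensorProduct

noncomputable section

namespace MatrixForms

/-- The algebra of differential forms with polynomial coefficients on the vector space `M_n(k)`:
polynomials in the coordinates `x_ij`, tensored with the exterior algebra of the dual space
of `M_n(k)`. The product is the wedge product; functions commute with all forms. -/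
abbrev Form (n : ℕ) (k : Type*) [Field k] : Type _ :=
  MvPolynomial (Fin n × Fin n) k ⊗[k]
    ExteriorAlgebra k (Module.Dual k (Matrix (Fin n) (Fin n) k))

/-- The generic matrix `X = (x_ij)`, with entries regarded as forms of degree zero. -/
def X (n : ℕ) (k : Type*) [Field k] : Matrix (Fin n) (Fin n) (Form n k) :=
  Matrix.of fun i j => (MvPolynomial.X (i, j)) ⊗ₜ[k] 1

/-- The matrix `dX = (dx_ij)` of one-forms; `dx_ij` is the constant one-form given by the linear
functional that sends a matrix to its `(i, j)` entry. -/
def dX (n : ℕ) (k : Type*) [Field k] : Matrix (Fin n) (Fin n) (Form n k) :=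
  Matrix.of fun i j => 1 ⊗ₜ[k] ExteriorAlgebra.ι k (Matrix.entryLinearMap k k i j)

/-- The adjoint action of `g` on matrices, `A ↦ g A g⁻¹`. -/
def ad {n : ℕ} {k : Type*} [Field k] (g : GL (Fin n) k) :
    Matrix (Fin n) (Fin n) k →ₗ[k] Matrix (Fin n) (Fin n) k where
  toFun A := g.val * A * g⁻¹.val
  map_add' A B := by rw [Matrix.mul_add, Matrix.add_mul]
  map_smul' c A := by simp

/-- Pullback of polynomial functions along `ad g`: the coordinate `x_ij` is sent to the `(i, j)`
entry of `g X g⁻¹`. -/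
def pullbackFun {n : ℕ} {k : Type*} [Field k] (g : GL (Fin n) k) :
    MvPolynomial (Fin n × Fin n) k →ₐ[k] MvPolynomial (Fin n × Fin n) k :=
  MvPolynomial.aeval fun ij =>
    (g.val.map MvPolynomial.C * Matrix.mvPolynomialX (Fin n) (Fin n) k *
      g⁻¹.val.map MvPolynomial.C : Matrix (Fin n) (Fin n) (MvPolynomial (Fin n × Fin n) k))
      ij.1 ij.2

/-- The pullback of a polynomial function `f` is the composite `f ∘ ad g`. -/
theorem eval_pullbackFun {n : ℕ} {k : Type*} [Field k] (g : GL (Fin n) k)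
    (f : MvPolynomial (Fin n × Fin n) k) (A : Matrix (Fin n) (Fin n) k) :
    MvPolynomial.eval (fun ij => A ij.1 ij.2) (pullbackFun g f) =
      MvPolynomial.eval (fun ij => ad g A ij.1 ij.2) f := by
  induction f using MvPolynomial.induction_on with
  | C a => simp [pullbackFun]
  | add p q hp hq => simp only [map_add, hp, hq]
  | mul_X p ij hp =>
    rw [map_mul, map_mul, map_mul, hp]
    congr 1
    simp [pullbackFun, ad, Matrix.mul_apply, map_sum]

/-- Pullback of differential forms along `ad g`: on coefficients it is the pullback of functions,
on constant one-forms it is the transpose of the linear map `ad g`. -/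
def pullback {n : ℕ} {k : Type*} [Field k] (g : GL (Fin n) k) :
    Form n k →ₐ[k] Form n k :=
  Algebra.TensorProduct.map (pullbackFun g) (ExteriorAlgebra.map (ad g).dualMap)

/-- The algebra of `GL_n(k)`-invariant polynomial differential forms on `M_n(k)`. -/
def invariantForms (n : ℕ) (k : Type*) [Field k] : Subalgebra k (Form n k) where
  carrier := {ω | ∀ g : GL (Fin n) k, pullback g ω = ω}
  mul_mem' ha hb g := by rw [map_mul, ha g, hb g]
  add_mem' ha hb g := by rw [map_add, ha g, hb g]
  algebraMap_mem' r g := (pullback g).commutes r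

/-- The form `Tr (X^ℓ₁ dX ∧ X^ℓ₂ dX ∧ ⋯ ∧ X^ℓₚ dX)` of degree `p`. -/
def traceForm {n : ℕ} {k : Type*} [Field k] {p : ℕ} (l : Fin p → ℕ) : Form n k :=
  Matrix.trace (List.ofFn fun i => X n k ^ l i * dX n k).prod

/-- The generators: the functions `Tr (X^ℓ)`, `ℓ ≥ 1`, in degree zero, and the trace forms of
all degrees `p ≥ 1`. -/
def generators (n : ℕ) (k : Type*) [Field k] : Set (Form n k) :=
  {ω | ∃ l : ℕ, 1 ≤ l ∧ ω = Matrix.trace (X n k ^ l)} ∪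
    {ω | ∃ p : ℕ, 1 ≤ p ∧ ∃ l : Fin p → ℕ, ω = traceForm l}

end MatrixForms

end

/-! Traces of words in `X` and `dX` are invariant because pullback conjugates both matrices by the
same scalar matrix. The substance is the converse. A form is recovered from its Taylor coefficients
at 0, taken in the even variables x_ij and the odd variables dx_ij (`exists_eq_sum_taylorTerm`). The
coefficients of degree m are multilinear functions of m matrices, and those of an invariant form are
invariant under simultaneous conjugation. By the first fundamental theorem (`exists_eq_sum_perm`, a
double commutant argument) they are combinations of permutations. Hence an invariant form is a
combination of contractions, products of entries of `X` and `dX` whose indices are linked by a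
permutation (`invariantForms_le_span`). Since the entries commute up to sign, the factors may be
rearranged along the cycles of the permutation, and each cycle gives the trace of a word in `X` and
`dX` (`contraction_mem`). As the entries of `X` are central, every such trace is a scalar or a
generator (`trace_mem_adjoin`). -/

namespace MatrixForms

/-! ### The first fundamental theorem for GL_n. -/

section FirstFundamentalTheorem

variable {k : Type*} [Field k] {n : ℕ} {I : Type*} [Fintype I]

/-- Two functions on a finite type with the same multiset of values differ by a permutation. -/
theorem exists_perm_comp_eq {α : Type*} (f g : I → α)
    (h : ∑ i, Finsupp.single (f i) 1 = ∑ i, Finsupp.single (g i) (1 : ℕ)) :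
    ∃ σ : Equiv.Perm I, f ∘ σ = g := by
  classical
  have hc (c : α) : Nonempty ({i // g i = c} ≃ {i // f i = c}) := by
    have := DFunLike.congr_fun h c
    simp only [Finsupp.coe_finsetSum, Finset.sum_apply, Finsupp.single_apply,
      Finset.sum_boole, Nat.cast_id] at this
    exact ⟨Fintype.equivOfCardEq (by rw [Fintype.card_subtype, Fintype.card_subtype, this])⟩
  refine ⟨Equiv.ofFiberEquiv fun c => (hc c).some, ?_⟩
  ext i
  exact Equiv.ofFiberEquiv_map _ i

/-- A polynomial in the entries of a matrix which vanishes on `GL_n(k)` is zero. -/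
theorem eq_of_eval_GL_eq [Infinite k] (p q : MvPolynomial (Fin n × Fin n) k)
    (h : ∀ g : GL (Fin n) k, MvPolynomial.eval (fun ij => g.val ij.1 ij.2) p =
      MvPolynomial.eval (fun ij => g.val ij.1 ij.2) q) : p = q := by
  have hdet := Matrix.det_mvPolynomialX_ne_zero (Fin n) k
  -- The product of p - q with the determinant vanishes at singular matrices too, and the polynomial
  -- ring is a domain.
  refine sub_eq_zero.1 ((mul_eq_zero_iff_right hdet).1 (MvPolynomial.funext fun x => ?_))
  let A : Matrix (Fin n) (Fin n) k := Matrix.of fun i j => x (i, j)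
  have hA : MvPolynomial.eval x (Matrix.mvPolynomialX (Fin n) (Fin n) k).det = A.det := by
    rw [RingHom.map_det]
    congr 1
    ext i j
    simp [A]
  rw [map_mul, map_sub, map_zero, hA]
  by_cases h0 : A.det = 0
  · rw [h0, mul_zero]
  · have := h (Matrix.GeneralLinearGroup.mkOfDetNeZero A h0)
    change MvPolynomial.eval x p = MvPolynomial.eval x q at this
    rw [this, sub_self, zero_mul]

theorem prod_X_eq_monomial {τ : Type*} (w : I → τ) :
    ∏ i, (MvPolynomial.X (w i) : MvPolynomial τ k) =
      MvPolynomial.monomial (∑ i, Finsupp.single (w i) 1) 1 := by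
  rw [MvPolynomial.monomial_sum_one]
  rfl

/-- A tensor commuting with all `g ⊗ ⋯ ⊗ g` commutes with everything that commutes with
permutations. -/
theorem commute_of_commute_GL [Infinite k] [DecidableEq I]
    (C D : Matrix (I → Fin n) (I → Fin n) k)
    (hC : ∀ g : GL (Fin n) k, C * Matrix.of (fun a b => ∏ i, g.val (a i) (b i)) =
      Matrix.of (fun a b => ∏ i, g.val (a i) (b i)) * C)
    (hD : ∀ (σ : Equiv.Perm I) a b, D (a ∘ σ) (b ∘ σ) = D a b) : C * D = D * C := by
  let μ : (I → Fin n) × (I → Fin n) → (Fin n × Fin n →₀ ℕ) :=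
    fun p => ∑ i, Finsupp.single (p.1 i, p.2 i) 1
  let D' : (I → Fin n) × (I → Fin n) → k := fun p => D p.1 p.2
  -- The monomial ∏ x_{a i, b i} determines (a, b) up to a simultaneous permutation, so the entries
  -- of D are the values of a linear functional on monomials.
  have hf : Function.FactorsThrough D' μ := by
    intro p q hpq
    obtain ⟨σ, hσ⟩ := exists_perm_comp_eq _ _ hpq
    have h1 : p.1 ∘ σ = q.1 := by
      ext i; exact congrArg (fun x => (x.1 : ℕ)) (congrFun hσ i)
    have h2 : p.2 ∘ σ = q.2 := by
      ext i; exact congrArg (fun x => (x.2 : ℕ)) (congrFun hσ i)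
    simp only [D']
    rw [← h1, ← h2, hD]
  let ℓ : MvPolynomial (Fin n × Fin n) k →ₗ[k] k :=
    (MvPolynomial.basisMonomials _ k).constr k (Function.extend μ D' 0)
  have hℓ (a b : I → Fin n) : ℓ (∏ i, MvPolynomial.X (a i, b i)) = D a b := by
    rw [prod_X_eq_monomial]
    refine Eq.trans ?_ (hf.extend_apply 0 (a, b))
    rw [← Module.Basis.constr_basis (MvPolynomial.basisMonomials (Fin n × Fin n) k) k
      (Function.extend μ D' 0), MvPolynomial.coe_basisMonomials]
  ext a b
  -- The hypothesis on C, read entrywise, is a polynomial identity on GL_n, hence holds for the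
  -- generic matrix. Applying `ℓ` replaces that matrix's tensor power by D.
  have key : ∑ e, C a e • ∏ i, (MvPolynomial.X (e i, b i) : MvPolynomial (Fin n × Fin n) k) =
      ∑ e, C e b • ∏ i, MvPolynomial.X (a i, e i) := by
    refine eq_of_eval_GL_eq _ _ fun g => ?_
    have := congrFun (congrFun (hC g) a) b
    simp only [Matrix.mul_apply, Matrix.of_apply] at this
    simpa [map_sum, map_prod, MvPolynomial.smul_eval, mul_comm] using this
  have := congrArg ℓ key
  simpa [map_sum, hℓ, Matrix.mul_apply, mul_comm] using this

/-- The matrix of the permutation `σ` of tensor factors. -/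
def permTensor (k : Type*) [Field k] {n : ℕ} {I : Type*} [Fintype I] (σ : Equiv.Perm I) :
    Matrix (I → Fin n) (I → Fin n) k :=
  Matrix.of fun a b => if a ∘ σ = b then 1 else 0

/-- Permutation of the tensor factors of the row index. -/
def permRows (k : Type*) [Field k] {n : ℕ} {I : Type*} [Fintype I] (σ : Equiv.Perm I) :
    Matrix (I → Fin n) (I → Fin n) k →ₗ[k] Matrix (I → Fin n) (I → Fin n) k where
  toFun B := Matrix.of fun a b => B (a ∘ σ) b
  map_add' _ _ := rfl
  map_smul' _ _ := rfl

theorem permRows_mul (σ τ : Equiv.Perm I) (B : Matrix (I → Fin n) (I → Fin n) k) :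
    permRows k σ (permRows k τ B) = permRows k (σ * τ) B := rfl

theorem permRows_mem_span (σ : Equiv.Perm I) {B : Matrix (I → Fin n) (I → Fin n) k}
    (hB : B ∈ Submodule.span k (Set.range (permTensor k))) :
    permRows k σ B ∈ Submodule.span k (Set.range (permTensor k)) := by
  refine Submodule.span_induction (p := fun B _ => permRows k σ B ∈ _) ?_ ?_ ?_ ?_ hB
  · rintro _ ⟨τ, rfl⟩
    exact Submodule.subset_span ⟨σ * τ, rfl⟩
  · rw [map_zero]
    exact zero_mem _
  · intro _ _ _ _ h1 h2
    rw [map_add]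
    exact add_mem h1 h2
  · intro c _ _ h
    rw [map_smul]
    exact Submodule.smul_mem _ _ h

/-- There is a projection onto the span of the permutations which commutes with the permutations
of the row index. -/
theorem exists_equivariant_projection [CharZero k] [DecidableEq I] :
    ∃ π : Matrix (I → Fin n) (I → Fin n) k →ₗ[k] Matrix (I → Fin n) (I → Fin n) k,
      (∀ B, π B ∈ Submodule.span k (Set.range (permTensor k))) ∧
      (∀ B ∈ Submodule.span k (Set.range (permTensor k)), π B = B) ∧
      ∀ (σ : Equiv.Perm I) B, π (permRows k σ B) = permRows k σ (π B) := by
  set A := Submodule.span k (Set.range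
    (permTensor k : Equiv.Perm I → Matrix (I → Fin n) (I → Fin n) k)) with hA
  obtain ⟨p, hp⟩ := A.subtype.exists_leftInverse_of_injective A.ker_subtype
  have hp' (B) (hB : B ∈ A) : (p B : Matrix (I → Fin n) (I → Fin n) k) = B :=
    congrArg Subtype.val (LinearMap.congr_fun hp ⟨B, hB⟩)
  -- Maschke averaging of an arbitrary linear projection.
  let π : Matrix (I → Fin n) (I → Fin n) k →ₗ[k] Matrix (I → Fin n) (I → Fin n) k :=
    (Fintype.card (Equiv.Perm I) : k)⁻¹ •
      ∑ σ : Equiv.Perm I, permRows k σ ∘ₗ A.subtype ∘ₗ p ∘ₗ permRows k σ⁻¹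
  have hπ (B) : π B = (Fintype.card (Equiv.Perm I) : k)⁻¹ •
      ∑ σ : Equiv.Perm I, permRows k σ (p (permRows k σ⁻¹ B)) := by
    simp [π]
  refine ⟨π, fun B => ?_, fun B hB => ?_, fun σ B => ?_⟩
  · rw [hπ]
    exact A.smul_mem _ (A.sum_mem fun σ _ => permRows_mem_span σ (p _).2)
  · have h1 (σ : Equiv.Perm I) : permRows k σ (p (permRows k σ⁻¹ B)) = B := by
      rw [hp' _ (permRows_mem_span σ⁻¹ hB), permRows_mul, mul_inv_cancel]
      rfl
    rw [hπ, Finset.sum_congr rfl fun σ _ => h1 σ, Finset.sum_const, Finset.card_univ,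
      ← Nat.cast_smul_eq_nsmul k, smul_smul, inv_mul_cancel₀, one_smul]
    exact_mod_cast Fintype.card_ne_zero
  · rw [hπ, hπ, map_smul, map_sum]
    congr 1
    refine Fintype.sum_equiv (Equiv.mulLeft σ⁻¹) _ _ fun τ => ?_
    rw [permRows_mul, permRows_mul, Equiv.coe_mulLeft, mul_inv_rev, inv_inv,
      mul_inv_cancel_left]

/-- The first fundamental theorem for `GL_n`: a tensor in `End(V)^{⊗ I}` commuting with all
`g ⊗ ⋯ ⊗ g` is a linear combination of permutations. -/
theorem exists_eq_sum_perm [CharZero k] [DecidableEq I]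
    (C : Matrix (I → Fin n) (I → Fin n) k)
    (hC : ∀ g : GL (Fin n) k, C * Matrix.of (fun a b => ∏ i, g.val (a i) (b i)) =
      Matrix.of (fun a b => ∏ i, g.val (a i) (b i)) * C) :
    ∃ c : Equiv.Perm I → k, C = ∑ σ, c σ • permTensor k σ := by
  obtain ⟨π, hπA, hπ1, hπσ⟩ := exists_equivariant_projection (k := k) (n := n) (I := I)
  have hπE (B : Matrix (I → Fin n) (I → Fin n) k) (a c : I → Fin n) :
      π B a c = ∑ b, ∑ d, B b d * π (Matrix.single b d 1) a c := by
    conv_lhs => rw [Matrix.matrix_eq_sum_single B]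
    simp only [map_sum, Matrix.sum_apply]
    refine Finset.sum_congr rfl fun b _ => Finset.sum_congr rfl fun d _ => ?_
    rw [← mul_one (B b d), ← smul_eq_mul, ← Matrix.smul_single, map_smul]
    simp
  have hD (d c : I → Fin n) (σ : Equiv.Perm I) (a b : I → Fin n) :
      π (Matrix.single (b ∘ σ) d 1) (a ∘ σ) c = π (Matrix.single b d 1) a c := by
    have h1 : permRows k σ (Matrix.single (b ∘ σ) d 1) = Matrix.single b d 1 := by
      ext x y
      have : b ∘ σ = x ∘ σ ↔ b = x := σ.surjective.injective_comp_right.eq_iff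
      change Matrix.single (b ∘ σ) d (1 : k) (x ∘ σ) y = _
      simp [Matrix.single_apply, this]
    rw [← h1, hπσ]
    rfl
  -- For fixed d and c, the matrix (a, b) ↦ π(E_{bd})_{ac} is invariant under simultaneous
  -- permutations, so C commutes with it. Expanded over matrix units, this says that π is C-linear.
  have hmul (B) : π (C * B) = C * π B := by
    ext a c
    have hcomm (d : I → Fin n) := commute_of_commute_GL C
      (Matrix.of fun a b => π (Matrix.single b d 1) a c) hC (hD d c)
    rw [hπE, Matrix.mul_apply]
    simp only [hπE B, Matrix.mul_apply, Finset.sum_mul, Finset.mul_sum]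
    have h2 (d e : I → Fin n) : ∑ b, C b e * π (Matrix.single b d 1) a c =
        ∑ b, C a b * π (Matrix.single e d 1) b c := by
      have := congrFun (congrFun (hcomm d) a) e
      simp only [Matrix.mul_apply, Matrix.of_apply] at this
      rw [this]
      exact Finset.sum_congr rfl fun _ _ => mul_comm _ _
    calc _ = ∑ d, ∑ e, B e d * ∑ b, C b e * π (Matrix.single b d 1) a c := by
            rw [Finset.sum_comm]
            refine Finset.sum_congr rfl fun d _ => ?_
            rw [Finset.sum_comm]
            refine Finset.sum_congr rfl fun e _ => ?_
            rw [Finset.mul_sum]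
            exact Finset.sum_congr rfl fun b _ => by ring
      _ = _ := by
            simp only [h2, Finset.mul_sum]
            rw [Finset.sum_comm]
            conv_rhs => rw [Finset.sum_comm]
            refine Finset.sum_congr rfl fun e _ => ?_
            rw [Finset.sum_comm]
            exact Finset.sum_congr rfl fun b _ => Finset.sum_congr rfl fun d _ => by ring
  have h1 : (1 : Matrix (I → Fin n) (I → Fin n) k) ∈
      Submodule.span k (Set.range (permTensor k)) := by
    refine Submodule.subset_span ⟨1, ?_⟩
    ext a b
    simp [permTensor, Matrix.one_apply]
  -- C = C π(1) = π(C).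
  have hCA : C ∈ Submodule.span k (Set.range (permTensor k)) := by
    have := hmul 1
    rw [mul_one, hπ1 1 h1, mul_one] at this
    rw [← this]
    exact hπA C
  obtain ⟨c, hc⟩ := (Submodule.mem_span_range_iff_exists_fun k).1 hCA
  exact ⟨c, hc.symm⟩

end FirstFundamentalTheorem

end MatrixForms

namespace MatrixForms

/-! ### Taylor's formula in even and odd variables. -/

section Taylor

variable {k U S : Type*} [Field k] [Ring U] [Algebra k U] [Fintype S]

/-- The unnormalised degree `m` term of the Taylor expansion, at the augmentation `ε`, of elements
of an algebra with coordinates `y s` and derivations `δ s`. -/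
def taylorTerm (y : S → U) (δ : S → Module.End k U) (ε : U →ₐ[k] k) (m : ℕ) : U →ₗ[k] U :=
  ∑ w : Fin m → S, (ε.toLinearMap ∘ₗ (List.ofFn fun i => δ (w i)).prod).smulRight
    (List.ofFn fun i => y (w i)).prod

variable {y : S → U} {δ : S → Module.End k U} {ε : U →ₐ[k] k}

theorem taylorTerm_apply (m : ℕ) (u : U) :
    taylorTerm y δ ε m u = ∑ w : Fin m → S,
      ε ((List.ofFn fun i => δ (w i)).prod u) • (List.ofFn fun i => y (w i)).prod := by
  simp [taylorTerm]

theorem taylorTerm_zero (u : U) : taylorTerm y δ ε 0 u = algebraMap k U (ε u) := by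
  simp [taylorTerm_apply, Algebra.algebraMap_eq_smul_one]

/-- Splits off the last letter of the word, whose derivation acts first and whose coordinate stands
rightmost. -/
theorem taylorTerm_succ (m : ℕ) (u : U) :
    taylorTerm y δ ε (m + 1) u = ∑ s, taylorTerm y δ ε m (δ s u) * y s := by
  simp only [taylorTerm_apply, Finset.sum_mul]
  rw [← (Fin.snocEquiv fun _ : Fin (m + 1) => S).sum_comp, Fintype.sum_prod_type]
  refine Finset.sum_congr rfl fun s _ => Finset.sum_congr rfl fun w _ => ?_
  rw [List.ofFn_succ', List.ofFn_succ', List.prod_concat, List.prod_concat, smul_mul_assoc]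
  simp [Fin.snocEquiv]

variable [DecidableEq S] {κ : S → S → k}

/-- Each derivation shortens words by one letter (`hlow`). Euler's identity (`heuler`) restores the
word with its length as a factor, and these factors accumulate to m!. -/
theorem taylorTerm_word (hδ1 : ∀ s, δ s 1 = 0)
    (hδ : ∀ s t u, δ s (u * y t) = (if s = t then u else 0) + κ s t • (δ s u * y t))
    (hy : ∀ s t, y t * y s = κ s t • (y s * y t) ∧ κ s t * κ s t = 1) (hε : ∀ s, ε (y s) = 0)
    (m : ℕ) (L : List S) :
    taylorTerm y δ ε m (L.map y).prod =
      if L.length = m then (m.factorial : k) • (L.map y).prod else 0 := by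
  have hlow (s : S) (L : List S) : δ s (L.map y).prod ∈
      Submodule.span k {u | ∃ L' : List S, L'.length + 1 = L.length ∧ u = (L'.map y).prod} := by
    induction L using List.reverseRecOn with
    | nil => simp [hδ1]
    | append_singleton L t ih =>
      rw [List.map_append, List.prod_append, List.map_singleton, List.prod_singleton, hδ]
      refine add_mem ?_ (Submodule.smul_mem _ _ ?_)
      · split_ifs
        · exact Submodule.subset_span ⟨L, by simp, rfl⟩
        · exact zero_mem _
      · refine Submodule.span_induction (p := fun u _ => u * y t ∈ _) ?_ ?_ ?_ ?_ ih
        · rintro _ ⟨L', hL', rfl⟩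
          exact Submodule.subset_span ⟨L' ++ [t], by simp [hL'], by simp⟩
        · rw [zero_mul]
          exact zero_mem _
        · intro _ _ _ _ h1 h2
          rw [add_mul]
          exact add_mem h1 h2
        · intro c _ _ h
          rw [smul_mul_assoc]
          exact Submodule.smul_mem _ _ h
  have heuler (L : List S) : ∑ s, δ s (L.map y).prod * y s = (L.length : k) • (L.map y).prod := by
    induction L using List.reverseRecOn with
    | nil => simp [hδ1]
    | append_singleton L t ih =>
      -- Moving y s back past y t produces κ a second time, and κ² = 1.
      have h1 (s : S) (u : U) : κ s t • (u * y t) * y s = u * y s * y t := by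
        rw [smul_mul_assoc, mul_assoc, (hy s t).1, mul_smul_comm, smul_smul, (hy s t).2, one_smul,
          mul_assoc]
      simp only [List.map_append, List.prod_append, List.map_singleton, List.prod_singleton, hδ,
        add_mul, h1, Finset.sum_add_distrib, ite_mul, zero_mul, Finset.sum_ite_eq',
        Finset.mem_univ, if_true, ← Finset.sum_mul, ih]
      simp [add_smul, add_comm]
  induction m generalizing L with
  | zero =>
    rw [taylorTerm_zero]
    cases L with
    | nil => simp
    | cons t L => simp [hε]
  | succ m ih =>
    have hspan (s : S) : taylorTerm y δ ε m (δ s (L.map y).prod) =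
        if L.length = m + 1 then (m.factorial : k) • δ s (L.map y).prod else 0 := by
      refine Submodule.span_induction (p := fun u _ => taylorTerm y δ ε m u =
        if L.length = m + 1 then (m.factorial : k) • u else 0) ?_ ?_ ?_ ?_ (hlow s L)
      · rintro _ ⟨L', hL', rfl⟩
        rw [ih, ← hL']
        simp
      · simp
      · intro u v _ _ h1 h2
        rw [map_add, h1, h2]
        split_ifs <;> simp
      · intro c u _ h
        rw [map_smul, h]
        split_ifs
        · rw [smul_comm]
        · simp
    rw [taylorTerm_succ]
    simp only [hspan]
    split_ifs with hL
    · simp only [smul_mul_assoc]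
      rw [← Finset.smul_sum, heuler, hL, smul_smul, Nat.factorial_succ, mul_comm]
      push_cast
      rfl
    · simp

/-- Taylor's formula. -/
theorem exists_eq_sum_taylorTerm [CharZero k] (hδ1 : ∀ s, δ s 1 = 0)
    (hδ : ∀ s t u, δ s (u * y t) = (if s = t then u else 0) + κ s t • (δ s u * y t))
    (hy : ∀ s t, y t * y s = κ s t • (y s * y t) ∧ κ s t * κ s t = 1) (hε : ∀ s, ε (y s) = 0)
    (htop : Algebra.adjoin k (Set.range y) = ⊤) (u : U) :
    ∃ N : ℕ, u = ∑ m ∈ Finset.range N, (m.factorial : k)⁻¹ • taylorTerm y δ ε m u := by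
  -- Allowing every larger N' lets the expansions of two summands be cut at a common bound.
  suffices h : ∃ N : ℕ, ∀ N' ≥ N,
      u = ∑ m ∈ Finset.range N', (m.factorial : k)⁻¹ • taylorTerm y δ ε m u from
    h.imp fun N hN => hN N le_rfl
  have hu : u ∈ Submodule.span k (Submonoid.closure (Set.range y) : Set U) := by
    rw [← Algebra.adjoin_eq_span, htop]
    trivial
  refine Submodule.span_induction (p := fun u _ => ∃ N : ℕ, ∀ N' ≥ N,
      u = ∑ m ∈ Finset.range N', (m.factorial : k)⁻¹ • taylorTerm y δ ε m u) ?_ ?_ ?_ ?_ hu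
  · intro x hx
    obtain ⟨l, hl, rfl⟩ := Submonoid.exists_list_of_mem_closure hx
    obtain ⟨L, rfl⟩ : l ∈ Set.range (List.map y) := by
      rw [Set.range_list_map]
      exact hl
    refine ⟨L.length + 1, fun N' hN' => ?_⟩
    simp only [taylorTerm_word hδ1 hδ hy hε]
    rw [Finset.sum_eq_single_of_mem L.length (Finset.mem_range.2 (by omega))
      fun m _ hm => by rw [if_neg hm.symm, smul_zero], if_pos rfl, smul_smul, inv_mul_cancel₀,
      one_smul]
    exact_mod_cast Nat.factorial_ne_zero _
  · exact ⟨0, fun _ _ => by simp⟩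
  · rintro a b _ _ ⟨N, hN⟩ ⟨M, hM⟩
    refine ⟨max N M, fun N' hN' => ?_⟩
    simp only [map_add, smul_add, Finset.sum_add_distrib]
    rw [← hN _ (le_trans (le_max_left _ _) hN'), ← hM _ (le_trans (le_max_right _ _) hN')]
  · rintro c a _ ⟨N, hN⟩
    refine ⟨N, fun N' hN' => ?_⟩
    simp only [map_smul]
    conv_lhs => rw [hN N' hN', Finset.smul_sum]
    exact Finset.sum_congr rfl fun _ _ => smul_comm _ _ _

end Taylor

end MatrixForms

/-! ### Derivatives, pullback and Taylor coefficients of forms. -/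

namespace MatrixForms

variable {n : ℕ} {k : Type*} [Field k]

/-- The matrix of coordinate functions (`false`) or of one-forms (`true`). -/
noncomputable def gen (n : ℕ) (k : Type*) [Field k] (η : Bool) : Matrix (Fin n) (Fin n) (Form n k) :=
  if η then dX n k else X n k

/-- The sign of the interchange of two generators of the given parities. -/
noncomputable def koszulSign (k : Type*) [Field k] (η θ : Bool) : k := if η && θ then -1 else 1

theorem koszulSign_mul_self (η θ : Bool) : koszulSign k η θ * koszulSign k η θ = 1 := by
  unfold koszulSign
  split_ifs <;> simp

theorem X_mul_comm (i j : Fin n) (u : Form n k) : u * X n k i j = X n k i j * u := by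
  induction u using TensorProduct.induction_on with
  | zero => simp
  | tmul f a => simp [X, mul_comm]
  | add u v hu hv => rw [add_mul, mul_add, hu, hv]

theorem neg_one_smul_form (u : Form n k) : (-1 : k) • u = -u := neg_one_smul k u

theorem gen_mul_gen (η θ : Bool) (i j p q : Fin n) :
    gen n k θ p q * gen n k η i j = koszulSign k η θ • (gen n k η i j * gen n k θ p q) := by
  cases η
  · simp [gen, koszulSign, X_mul_comm i j]
  cases θ
  · simp [gen, koszulSign, X_mul_comm p q]
  · have h : koszulSign k true true = -1 := rfl
    rw [h, neg_one_smul_form]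
    simp only [gen, dX, if_true, Matrix.of_apply, Algebra.TensorProduct.tmul_mul_tmul, mul_one]
    rw [eq_neg_iff_add_eq_zero, ← TensorProduct.tmul_add, ExteriorAlgebra.ι_add_mul_swap,
      TensorProduct.tmul_zero]

theorem sum_dual_apply_single_smul (φ : Module.Dual k (Matrix (Fin n) (Fin n) k)) :
    φ = ∑ i, ∑ j, φ (Matrix.single i j 1) • Matrix.entryLinearMap k k i j := by
  ext A
  conv_lhs => rw [Matrix.matrix_eq_sum_single A]
  simp only [map_sum, LinearMap.coe_sum, Finset.sum_apply, LinearMap.smul_apply,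
    Matrix.entryLinearMap_apply, smul_eq_mul]
  refine Finset.sum_congr rfl fun i _ => Finset.sum_congr rfl fun j _ => ?_
  rw [← mul_one (A i j), ← smul_eq_mul, ← Matrix.smul_single, map_smul, smul_eq_mul, smul_eq_mul,
    mul_one, mul_comm]

theorem adjoin_gen : Algebra.adjoin k
    (Set.range fun s : Bool × Fin n × Fin n => gen n k s.1 s.2.1 s.2.2) = ⊤ := by
  set S := Algebra.adjoin k
    (Set.range fun s : Bool × Fin n × Fin n => gen n k s.1 s.2.1 s.2.2) with hS
  have hgen (s : Bool × Fin n × Fin n) : gen n k s.1 s.2.1 s.2.2 ∈ S :=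
    Algebra.subset_adjoin ⟨s, rfl⟩
  have hpol (f : MvPolynomial (Fin n × Fin n) k) : (f ⊗ₜ 1 : Form n k) ∈ S := by
    induction f using MvPolynomial.induction_on with
    | C a =>
      have : ((MvPolynomial.C a) ⊗ₜ 1 : Form n k) = algebraMap k _ a := by
        rw [Algebra.TensorProduct.algebraMap_apply]
        rfl
      rw [this]
      exact S.algebraMap_mem a
    | add p q hp hq =>
      rw [TensorProduct.add_tmul]
      exact add_mem hp hq
    | mul_X p ij hp =>
      have : ((p * MvPolynomial.X ij) ⊗ₜ 1 : Form n k) = p ⊗ₜ 1 * gen n k false ij.1 ij.2 := by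
        simp [gen, X]
      rw [this]
      exact mul_mem hp (hgen (false, ij))
  have hext (a : ExteriorAlgebra k (Module.Dual k (Matrix (Fin n) (Fin n) k))) :
      (1 ⊗ₜ a : Form n k) ∈ S := by
    induction a using ExteriorAlgebra.induction with
    | algebraMap r =>
      rw [Algebra.algebraMap_eq_smul_one, TensorProduct.tmul_smul]
      exact S.smul_mem S.one_mem r
    | ι φ =>
      rw [sum_dual_apply_single_smul φ]
      simp only [map_sum, map_smul, TensorProduct.tmul_sum, TensorProduct.tmul_smul]
      exact sum_mem fun i _ => sum_mem fun j _ => S.smul_mem (hgen (true, i, j)) _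
    | mul a b ha hb =>
      have := mul_mem ha hb
      rwa [Algebra.TensorProduct.tmul_mul_tmul, mul_one] at this
    | add a b ha hb =>
      rw [TensorProduct.tmul_add]
      exact add_mem ha hb
  refine eq_top_iff.2 fun u _ => ?_
  induction u using TensorProduct.induction_on with
  | zero => exact zero_mem _
  | tmul f a =>
    have := mul_mem (hpol f) (hext a)
    rwa [Algebra.TensorProduct.tmul_mul_tmul, mul_one, one_mul] at this
  | add u v hu hv => exact add_mem (hu trivial) (hv trivial)

theorem form_induction {p : Form n k → Prop} (hp1 : p 1)
    (hadd : ∀ u v, p u → p v → p (u + v)) (hsmul : ∀ (c : k) u, p u → p (c • u))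
    (hmul : ∀ u η i j, p u → p (u * gen n k η i j)) (u : Form n k) : p u := by
  have hu : u ∈ Submodule.span k (Submonoid.closure
      (Set.range fun s : Bool × Fin n × Fin n => gen n k s.1 s.2.1 s.2.2) : Set (Form n k)) := by
    rw [← Algebra.adjoin_eq_span, adjoin_gen]
    trivial
  refine Submodule.span_induction (p := fun u _ => p u) (fun x hx => ?_) ?_
    (fun a b _ _ => hadd a b) (fun c a _ => hsmul c a) hu
  · refine Submonoid.closure_induction_right (motive := fun x _ => p x) hp1 ?_ hx
    rintro x _ _ ⟨s, rfl⟩ h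
    exact hmul _ _ _ _ h
  · rw [← zero_smul k (1 : Form n k)]
    exact hsmul _ _ hp1

/-- The derivative of a polynomial function in the direction of a matrix. -/
noncomputable def dirDeriv (n : ℕ) (k : Type*) [Field k] :
    Matrix (Fin n) (Fin n) k →ₗ[k] Module.End k (MvPolynomial (Fin n × Fin n) k) :=
  ∑ i, ∑ j, (Matrix.entryLinearMap k k i j).smulRight
    (MvPolynomial.pderiv (R := k) (i, j)).toLinearMap

theorem dirDeriv_apply (A : Matrix (Fin n) (Fin n) k) (f : MvPolynomial (Fin n × Fin n) k) :
    dirDeriv n k A f = ∑ i, ∑ j, A i j • MvPolynomial.pderiv (i, j) f := by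
  simp [dirDeriv]

theorem dirDeriv_mul_X (A : Matrix (Fin n) (Fin n) k) (f : MvPolynomial (Fin n × Fin n) k)
    (i j : Fin n) : dirDeriv n k A (f * MvPolynomial.X (i, j)) =
      A i j • f + dirDeriv n k A f * MvPolynomial.X (i, j) := by
  simp only [dirDeriv_apply, Derivation.leibniz, MvPolynomial.pderiv_X, smul_add,
    Finset.sum_add_distrib, Finset.sum_mul]
  congr 1
  · rw [Finset.sum_eq_single i (fun a _ ha => Finset.sum_eq_zero fun b _ => by simp [ha.symm])
      (by simp), Finset.sum_eq_single j (fun b _ hb => by simp [hb.symm]) (by simp)]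
    simp
  · refine Finset.sum_congr rfl fun a _ => Finset.sum_congr rfl fun b _ => ?_
    rw [smul_eq_mul, mul_comm, smul_mul_assoc]

/-- The even and odd derivatives of a differential form in the direction of a matrix: the
derivative of the coefficients, and the contraction (from the right). -/
noncomputable def formDeriv (n : ℕ) (k : Type*) [Field k] (η : Bool) :
    Matrix (Fin n) (Fin n) k →ₗ[k] Module.End k (Form n k) :=
  if η then LinearMap.lTensorHom _ ∘ₗ CliffordAlgebra.contractRight.flip ∘ₗ Module.Dual.eval k _
  else LinearMap.rTensorHom _ ∘ₗ dirDeriv n k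

theorem formDeriv_one (η : Bool) (A : Matrix (Fin n) (Fin n) k) : formDeriv n k η A 1 = 0 := by
  rw [Algebra.TensorProduct.one_def]
  cases η
  · simp [formDeriv, dirDeriv_apply]
  · simp [formDeriv]

/-- Supplies the twisted Leibniz rule for Taylor's formula. Contracting from the right removes the
last factor without a sign and gives the sign to the other term. -/
theorem formDeriv_mul_gen (η θ : Bool) (A : Matrix (Fin n) (Fin n) k) (i j : Fin n)
    (u : Form n k) : formDeriv n k η A (u * gen n k θ i j) =
      (if η = θ then A i j • u else 0) +
        koszulSign k η θ • (formDeriv n k η A u * gen n k θ i j) := by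
  induction u using TensorProduct.induction_on with
  | zero => simp
  | tmul f a =>
    cases η <;> cases θ
    · simp [formDeriv, koszulSign, gen, X, dirDeriv_mul_X, TensorProduct.add_tmul,
        TensorProduct.smul_tmul']
    · simp [formDeriv, koszulSign, gen, dX]
    · simp [formDeriv, koszulSign, gen, X]
    · have := CliffordAlgebra.contractRight_mul_ι (Q := 0)
        (Module.Dual.eval k (Matrix (Fin n) (Fin n) k) A) (Matrix.entryLinearMap k k i j) a
      have h : koszulSign k true true = -1 := rfl
      rw [h, neg_one_smul_form]
      simp only [formDeriv, gen, dX, if_true, LinearMap.comp_apply, Matrix.of_apply,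
        Algebra.TensorProduct.tmul_mul_tmul, mul_one, LinearMap.coe_lTensorHom,
        LinearMap.lTensor_tmul, LinearMap.flip_apply]
      rw [ExteriorAlgebra.ι, this, TensorProduct.tmul_sub, TensorProduct.tmul_smul,
        sub_eq_add_neg]
      rfl
  | add u v hu hv =>
    rw [add_mul, map_add, hu, hv, map_add, add_mul, smul_add]
    split_ifs
    · simp only [smul_add]
      abel
    · simp only [smul_add, zero_add]

/-- The augmentation of the algebra of forms: the value at `0` of the degree zero part. -/
noncomputable def augmentation (n : ℕ) (k : Type*) [Field k] : Form n k →ₐ[k] k :=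
  Algebra.TensorProduct.productMap (MvPolynomial.aeval 0) ExteriorAlgebra.algebraMapInv

theorem augmentation_gen (η : Bool) (i j : Fin n) : augmentation n k (gen n k η i j) = 0 := by
  cases η
  · simp [augmentation, gen, X]
  · simp [augmentation, gen, dX, ExteriorAlgebra.algebraMapInv]

theorem pullback_gen (g : GL (Fin n) k) (η : Bool) (i j : Fin n) :
    pullback g (gen n k η i j) = ∑ p, ∑ q, (g.val i p * g⁻¹.val q j) • gen n k η p q := by
  cases η
  · simp only [gen, X, pullback, Bool.false_eq_true, if_false, Matrix.of_apply,
      Algebra.TensorProduct.map_tmul, map_one, pullbackFun, MvPolynomial.aeval_X, Matrix.mul_apply,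
      Matrix.map_apply, Matrix.mvPolynomialX_apply, Finset.sum_mul, TensorProduct.sum_tmul]
    rw [Finset.sum_comm]
    refine Finset.sum_congr rfl fun p _ => Finset.sum_congr rfl fun q _ => ?_
    rw [TensorProduct.smul_tmul', MvPolynomial.smul_eq_C_mul, map_mul]
    congr 1
    ring
  · simp only [gen, dX, pullback, if_true, Matrix.of_apply,
      Algebra.TensorProduct.map_tmul, map_one, ExteriorAlgebra.map_apply_ι]
    have : (ad g).dualMap (Matrix.entryLinearMap k k i j) =
        ∑ p, ∑ q, (g.val i p * g⁻¹.val q j) • Matrix.entryLinearMap k k p q := by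
      ext A
      simp only [ad, LinearMap.dualMap_apply, LinearMap.coe_mk, AddHom.coe_mk,
        Matrix.entryLinearMap_apply, Matrix.mul_apply, Finset.sum_mul, LinearMap.coe_sum,
        Finset.sum_apply, LinearMap.smul_apply, smul_eq_mul]
      rw [Finset.sum_comm]
      refine Finset.sum_congr rfl fun p _ => Finset.sum_congr rfl fun q _ => ?_
      ring
    simp only [this, map_sum, map_smul, TensorProduct.tmul_sum, TensorProduct.tmul_smul]

/-- The chain rule for the linear map `ad g`. -/
theorem formDeriv_pullback (g : GL (Fin n) k) (η : Bool) (A : Matrix (Fin n) (Fin n) k)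
    (u : Form n k) :
    formDeriv n k η A (pullback g u) = pullback g (formDeriv n k η (ad g A) u) := by
  induction u using form_induction with
  | hp1 => rw [map_one, formDeriv_one, formDeriv_one, map_zero]
  | hadd u v hu hv => simp only [map_add, hu, hv]
  | hsmul c u hu => simp only [map_smul, hu]
  | hmul u θ i j hu =>
    rw [map_mul (pullback g), pullback_gen, formDeriv_mul_gen, map_add, map_smul,
      map_mul (pullback g), pullback_gen]
    simp only [Finset.mul_sum, mul_smul_comm, map_sum, map_smul, formDeriv_mul_gen, hu, smul_add,
      Finset.sum_add_distrib, Finset.smul_sum]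
    congr 1
    · split_ifs
      · rw [map_smul]
        simp only [smul_smul, ← Finset.sum_smul]
        congr 1
        simp only [ad, LinearMap.coe_mk, AddHom.coe_mk, Matrix.mul_apply, Finset.sum_mul]
        rw [Finset.sum_comm]
        refine Finset.sum_congr rfl fun p _ => Finset.sum_congr rfl fun q _ => ?_
        ring
      · simp
    · refine Finset.sum_congr rfl fun p _ => Finset.sum_congr rfl fun q _ => ?_
      rw [smul_comm]

theorem augmentation_pullback (g : GL (Fin n) k) (u : Form n k) :
    augmentation n k (pullback g u) = augmentation n k u := by
  induction u using form_induction with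
  | hp1 => rw [map_one]
  | hadd u v hu hv => simp only [map_add, hu, hv]
  | hsmul c u hu => simp only [map_smul, hu]
  | hmul u η i j hu => simp [pullback_gen, augmentation_gen]

/-- The multilinear coefficients of a form. -/
noncomputable def coeffMap {m : ℕ} (η : Fin m → Bool) (u : Form n k) :
    MultilinearMap k (fun _ : Fin m => Matrix (Fin n) (Fin n) k) k :=
  ((augmentation n k).toLinearMap ∘ₗ LinearMap.applyₗ u).compMultilinearMap
    ((MultilinearMap.mkPiAlgebraFin k m (Module.End k (Form n k))).compLinearMap
      fun i => formDeriv n k (η i))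

theorem coeffMap_apply {m : ℕ} (η : Fin m → Bool) (u : Form n k)
    (A : Fin m → Matrix (Fin n) (Fin n) k) : coeffMap η u A =
      augmentation n k ((List.ofFn fun i => formDeriv n k (η i) (A i)).prod u) := rfl

/-- The pullback moves out through the derivatives and is absorbed by the augmentation, since `ad g`
fixes 0. -/
theorem coeffMap_pullback {m : ℕ} (η : Fin m → Bool) (u : Form n k) (g : GL (Fin n) k)
    (A : Fin m → Matrix (Fin n) (Fin n) k) :
    coeffMap η (pullback g u) A = coeffMap η u fun i => ad g (A i) := by
  simp only [coeffMap_apply]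
  rw [← augmentation_pullback g ((List.ofFn fun i => formDeriv n k (η i) (ad g (A i))).prod u)]
  congr 1
  induction m with
  | zero => simp
  | succ m ih =>
    simp only [List.ofFn_succ, List.prod_cons, Module.End.mul_apply]
    rw [ih (fun i => η i.succ) (fun i => A i.succ), formDeriv_pullback]

theorem exists_coeffMap_eq_sum_perm [CharZero k] {m : ℕ} (η : Fin m → Bool) {u : Form n k}
    (hu : u ∈ invariantForms n k) : ∃ c : Equiv.Perm (Fin m) → k, ∀ r s : Fin m → Fin n,
      coeffMap η u (fun i => Matrix.single (r i) (s i) 1) =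
        ∑ σ, c σ * if s ∘ σ = r then 1 else 0 := by
  -- Column indices s label the rows of C and row indices r its columns. With this transposition,
  -- invariance of the coefficients becomes commutation with g ⊗ ⋯ ⊗ g.
  let C : Matrix (Fin m → Fin n) (Fin m → Fin n) k :=
    Matrix.of fun s r => coeffMap η u fun i => Matrix.single (r i) (s i) 1
  have hC (g : GL (Fin n) k) : C * Matrix.of (fun a b => ∏ i, g.val (a i) (b i)) =
      Matrix.of (fun a b => ∏ i, g.val (a i) (b i)) * C := by
    -- Evaluating the invariance at B g eliminates g⁻¹.
    have hinv (B : Fin m → Matrix (Fin n) (Fin n) k) :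
        coeffMap η u (fun i => B i * g.val) = coeffMap η u (fun i => g.val * B i) := by
      conv_lhs => rw [← hu g, coeffMap_pullback]
      congr 1
      ext1 i
      simp [ad, Matrix.mul_assoc]
    have hr (a b : Fin n) : Matrix.single a b (1 : k) * g.val =
        ∑ q, g.val b q • Matrix.single a q 1 := by
      ext x y
      simp [Matrix.mul_apply, Matrix.single_apply, Matrix.sum_apply, ite_and]
    have hl (a b : Fin n) : g.val * Matrix.single a b (1 : k) =
        ∑ p, g.val p a • Matrix.single p b 1 := by
      ext x y
      simp [Matrix.mul_apply, Matrix.single_apply, Matrix.sum_apply, ite_and]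
    ext s r
    have := hinv fun i => Matrix.single (r i) (s i) 1
    simp only [hr, hl, MultilinearMap.map_sum, MultilinearMap.map_smul_univ, smul_eq_mul] at this
    simp only [C, Matrix.mul_apply, Matrix.of_apply]
    rw [this]
    exact Finset.sum_congr rfl fun _ _ => mul_comm _ _
  obtain ⟨c, hc⟩ := exists_eq_sum_perm C hC
  refine ⟨c, fun r s => ?_⟩
  refine (congrFun (congrFun hc s) r).trans ?_
  simp [Matrix.sum_apply, permTensor]

/-- Every invariant form is a linear combination of contractions of the generators along
permutations. -/
theorem invariantForms_le_span [CharZero k] : Subalgebra.toSubmodule (invariantForms n k) ≤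
    Submodule.span k {u | ∃ (m : ℕ) (η : Fin m → Bool) (σ : Equiv.Perm (Fin m)),
      u = ∑ r : Fin m → Fin n, (List.ofFn fun i => gen n k (η i) (r i) (r (σ i))).prod} := by
  intro u hu
  obtain ⟨N, hN⟩ := exists_eq_sum_taylorTerm
    (y := fun s : Bool × Fin n × Fin n => gen n k s.1 s.2.1 s.2.2)
    (δ := fun s => formDeriv n k s.1 (Matrix.single s.2.1 s.2.2 1)) (ε := augmentation n k)
    (κ := fun s t => koszulSign k s.1 t.1) (fun s => formDeriv_one _ _)
    (fun s t u => by
      rw [formDeriv_mul_gen]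
      congr 1
      obtain ⟨η, i, j⟩ := s
      obtain ⟨θ, p, q⟩ := t
      by_cases h1 : η = θ <;> by_cases h2 : i = p <;> by_cases h3 : j = q <;>
        simp [h1, h2, h3])
    (fun s t => ⟨gen_mul_gen _ _ _ _ _ _, koszulSign_mul_self _ _⟩)
    (fun s => augmentation_gen _ _ _) adjoin_gen u
  rw [hN]
  refine sum_mem fun m _ => Submodule.smul_mem _ _ ?_
  rw [taylorTerm_apply]
  have e1 : (∑ w : Fin m → Bool × Fin n × Fin n,
      augmentation n k ((List.ofFn fun i => formDeriv n k (w i).1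
        (Matrix.single (w i).2.1 (w i).2.2 1)).prod u) •
      (List.ofFn fun i => gen n k (w i).1 (w i).2.1 (w i).2.2).prod) =
      ∑ η : Fin m → Bool, ∑ r : Fin m → Fin n, ∑ s : Fin m → Fin n,
        coeffMap η u (fun i => Matrix.single (r i) (s i) 1) •
          (List.ofFn fun i => gen n k (η i) (r i) (s i)).prod := by
    simp only [coeffMap_apply]
    rw [← (Equiv.arrowProdEquivProdArrow (Fin m) (fun _ => Bool)
      (fun _ => Fin n × Fin n)).symm.sum_comp, Fintype.sum_prod_type]
    refine Finset.sum_congr rfl fun η _ => ?_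
    rw [← (Equiv.arrowProdEquivProdArrow (Fin m) (fun _ => Fin n)
      (fun _ => Fin n)).symm.sum_comp, Fintype.sum_prod_type]
    rfl
  rw [e1]
  refine sum_mem fun η _ => ?_
  obtain ⟨c, hc⟩ := exists_coeffMap_eq_sum_perm η hu
  have e2 : (∑ r : Fin m → Fin n, ∑ s : Fin m → Fin n,
        coeffMap η u (fun i => Matrix.single (r i) (s i) 1) •
          (List.ofFn fun i => gen n k (η i) (r i) (s i)).prod) =
      ∑ σ : Equiv.Perm (Fin m), c σ • ∑ r : Fin m → Fin n,
        (List.ofFn fun i => gen n k (η i) (r i) (r (σ⁻¹ i))).prod := by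
    simp only [hc, Finset.sum_smul, Finset.smul_sum]
    rw [Finset.sum_comm' (t' := Finset.univ) (s' := fun _ => Finset.univ) (by simp)]
    conv_rhs => rw [Finset.sum_comm]
    conv_lhs => rw [Finset.sum_comm]
    refine Finset.sum_congr rfl fun r _ => ?_
    rw [Finset.sum_comm]
    refine Finset.sum_congr rfl fun σ _ => ?_
    -- The condition s ∘ σ = r leaves the single index s = r ∘ σ⁻¹.
    rw [Finset.sum_eq_single (r ∘ ⇑σ⁻¹)]
    · have : (r ∘ ⇑σ⁻¹) ∘ σ = r := by
        ext i
        simp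
      rw [if_pos this, mul_one]
      rfl
    · intro s _ hs
      have : s ∘ σ ≠ r := by
        rintro rfl
        exact hs (by ext i; simp)
      rw [if_neg this, mul_zero, zero_smul]
    · simp
  rw [e2]
  exact sum_mem fun σ _ => Submodule.smul_mem _ _ (Submodule.subset_span ⟨m, η, σ⁻¹, rfl⟩)

end MatrixForms

namespace MatrixForms

/-! ### Contractions along permutations as products of traces. -/

section Contraction

variable {k R : Type*} [Field k] [Ring R] [Algebra k R] {n : ℕ}

/-- The entries of `A` and `B` commute up to a fixed scalar. -/
def ScalarCommute (k : Type*) {R : Type*} [Field k] [Ring R] [Algebra k R] {n : ℕ}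
    (A B : Matrix (Fin n) (Fin n) R) : Prop :=
  ∃ c : k, ∀ a b p q, A a b * B p q = c • (B p q * A a b)

theorem ScalarCommute.one_right (A : Matrix (Fin n) (Fin n) R) : ScalarCommute k A 1 :=
  ⟨1, fun a b p q => by rw [Matrix.one_apply]; split_ifs <;> simp⟩

theorem ScalarCommute.one_left (A : Matrix (Fin n) (Fin n) R) : ScalarCommute k 1 A :=
  ⟨1, fun a b p q => by rw [Matrix.one_apply]; split_ifs <;> simp⟩

theorem ScalarCommute.mul_right {A B C : Matrix (Fin n) (Fin n) R} (h1 : ScalarCommute k A B)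
    (h2 : ScalarCommute k A C) : ScalarCommute k A (B * C) := by
  obtain ⟨c, hc⟩ := h1
  obtain ⟨d, hd⟩ := h2
  refine ⟨c * d, fun a b p q => ?_⟩
  simp only [Matrix.mul_apply, Finset.mul_sum, Finset.sum_mul, Finset.smul_sum]
  refine Finset.sum_congr rfl fun x _ => ?_
  rw [← mul_assoc, hc, smul_mul_assoc, mul_assoc, hd, mul_smul_comm, smul_smul, mul_assoc]

theorem ScalarCommute.mul_left {A B C : Matrix (Fin n) (Fin n) R} (h1 : ScalarCommute k A C)
    (h2 : ScalarCommute k B C) : ScalarCommute k (A * B) C := by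
  obtain ⟨c, hc⟩ := h1
  obtain ⟨d, hd⟩ := h2
  refine ⟨d * c, fun a b p q => ?_⟩
  simp only [Matrix.mul_apply, Finset.mul_sum, Finset.sum_mul, Finset.smul_sum]
  refine Finset.sum_congr rfl fun x _ => ?_
  rw [mul_assoc, hd, mul_smul_comm, ← mul_assoc, hc, smul_mul_assoc, smul_smul, mul_assoc]

theorem ScalarCommute.of_mem_closure {s : Set (Matrix (Fin n) (Fin n) R)}
    (hs : ∀ A ∈ s, ∀ B ∈ s, ScalarCommute k A B) {A B : Matrix (Fin n) (Fin n) R}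
    (hA : A ∈ Submonoid.closure s) (hB : B ∈ Submonoid.closure s) : ScalarCommute k A B := by
  induction hA using Submonoid.closure_induction with
  | mem A hA =>
    induction hB using Submonoid.closure_induction with
    | mem B hB => exact hs A hA B hB
    | one => exact .one_right A
    | mul B C _ _ h1 h2 => exact h1.mul_right h2
  | one => exact .one_left B
  | mul A C _ _ h1 h2 => exact h1.mul_left h2

/-- The scalar does not depend on the indices a and b, so factors can be reordered under a sum over
indices. -/
theorem exists_smul_prod_of_perm {m : ℕ} {Y : Fin m → Matrix (Fin n) (Fin n) R}
    (hY : ∀ i j, ScalarCommute k (Y i) (Y j)) {L L' : List (Fin m)} (h : L.Perm L') :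
    ∃ c : k, ∀ a b : Fin m → Fin n, (L.map fun i => Y i (a i) (b i)).prod =
      c • (L'.map fun i => Y i (a i) (b i)).prod := by
  induction h with
  | nil => exact ⟨1, by simp⟩
  | cons x _ ih =>
    obtain ⟨c, hc⟩ := ih
    exact ⟨c, fun a b => by
      rw [List.map_cons, List.map_cons, List.prod_cons, List.prod_cons, hc, mul_smul_comm]⟩
  | swap x y l =>
    obtain ⟨c, hc⟩ := hY y x
    exact ⟨c, fun a b => by
      simp only [List.map_cons, List.prod_cons, ← mul_assoc, hc, smul_mul_assoc]⟩
  | trans _ _ ih1 ih2 =>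
    obtain ⟨c, hc⟩ := ih1
    obtain ⟨d, hd⟩ := ih2
    exact ⟨c * d, fun a b => by rw [hc, hd, smul_smul]⟩

theorem sum_prod_ofFn {m : ℕ} (f : Fin m → Fin n → R) :
    ∑ r : Fin m → Fin n, (List.ofFn fun i => f i (r i)).prod =
      (List.ofFn fun i => ∑ x, f i x).prod := by
  induction m with
  | zero => simp
  | succ m ih =>
    rw [← (Fin.consEquiv fun _ : Fin (m + 1) => Fin n).sum_comp, Fintype.sum_prod_type]
    simp only [Fin.consEquiv_apply, List.ofFn_succ, List.prod_cons, Fin.cons_zero, Fin.cons_succ]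
    rw [← ih fun i => f i.succ, Finset.sum_mul]
    exact Finset.sum_congr rfl fun x _ => by rw [Finset.mul_sum]

/-- Exchanging x with the value of r at j is an involution on the pairs (r, x). -/
theorem sum_sum_update {m : ℕ} (j : Fin m) (F : (Fin m → Fin n) → R) :
    ∑ r : Fin m → Fin n, ∑ x, F (Function.update r j x) = n • ∑ r, F r := by
  have h : ∑ r : Fin m → Fin n, ∑ _x : Fin n, F r = n • ∑ r, F r := by
    simp [Finset.smul_sum]
  rw [← h, ← Fintype.sum_prod_type', ← Fintype.sum_prod_type']
  refine Finset.sum_bij' (fun p _ => (Function.update p.1 j p.2, p.1 j))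
    (fun p _ => (Function.update p.1 j p.2, p.1 j)) ?_ ?_ ?_ ?_ ?_ <;> simp

variable (S : Subalgebra k R) (W : Submonoid (Matrix (Fin n) (Fin n) R))

/-- The contraction of a product of matrices with scalar-commuting entries along a permutation is
generated by traces. -/
theorem contraction_mem (hW : ∀ A ∈ W, ∀ B ∈ W, ScalarCommute k A B)
    (hS : ∀ A ∈ W, A.trace ∈ S) (hn : (n : k) ≠ 0) {m : ℕ} (σ : Equiv.Perm (Fin m))
    (Y : Fin m → Matrix (Fin n) (Fin n) R) (hY : ∀ i, Y i ∈ W) (L : List (Fin m))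
    (hL : L.Perm (List.finRange m)) :
    ∑ r : Fin m → Fin n, (L.map fun i => Y i (r i) (r (σ i))).prod ∈ S := by
  induction hd : σ.support.card using Nat.strong_induction_on generalizing σ Y L with
  | _ d ih =>
  subst hd
  have hYY (i j) := hW _ (hY i) _ (hY j)
  by_cases hσ : σ = 1
  -- Without linked indices the sum factors into the traces of the Y i.
  · subst hσ
    obtain ⟨c, hc⟩ := exists_smul_prod_of_perm hYY hL
    simp only [Equiv.Perm.one_apply, hc, ← Finset.smul_sum, ← List.ofFn_eq_map]
    rw [sum_prod_ofFn fun i x => Y i x x]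
    refine S.smul_mem (list_prod_mem fun x hx => ?_) c
    obtain ⟨i, rfl⟩ := (List.mem_ofFn' _ _).1 hx
    exact hS _ (hY i)
  obtain ⟨i, hi⟩ : ∃ i, σ i ≠ i := by
    by_contra! h
    exact hσ (Equiv.ext h)
  obtain ⟨j, hj⟩ : ∃ j, j = σ i := ⟨_, rfl⟩
  have hji : j ≠ i := hj ▸ hi
  have hσj : σ j ≠ j := fun h => hji (σ.injective (h.trans hj))
  have hmem (l) : l ∈ L := hL.mem_iff.2 (List.mem_finRange l)
  have hLi : L.Perm (i :: j :: (L.erase i).erase j) :=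
    (List.perm_cons_erase (hmem i)).trans
      ((List.perm_cons_erase ((List.mem_erase_of_ne hji).2 (hmem j))).cons i)
  set L₀ := (L.erase i).erase j
  have hnodup : (i :: j :: L₀).Nodup :=
    (hLi.symm.trans hL).nodup_iff.2 (List.nodup_finRange m)
  simp only [List.nodup_cons, List.mem_cons, not_or] at hnodup
  obtain ⟨⟨-, hi0⟩, hj0, -⟩ := hnodup
  obtain ⟨c, hc⟩ := exists_smul_prod_of_perm hYY hLi
  simp only [fun r : Fin m → Fin n => hc r fun l => r (σ l), ← Finset.smul_sum]
  refine S.smul_mem ?_ c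
  -- Merge the adjacent factors i and j = σ i of a cycle: Y i * Y j sits at i, and j becomes a fixed
  -- point carrying the identity matrix. The freed index at j contributes a factor n, which is why n
  -- must be invertible.
  let Y' := Function.update (Function.update Y i (Y i * Y j)) j 1
  have hY' (l) : Y' l ∈ W := by
    simp only [Y', Function.update_apply]
    split_ifs
    · exact one_mem W
    · exact mul_mem (hY i) (hY j)
    · exact hY l
  have key := ih _ (Equiv.Perm.card_support_swap_mul hσj) _ Y' hY' _ (hLi.symm.trans hL) rfl
  let F : (Fin m → Fin n) → R :=
    fun r => ((i :: j :: L₀).map fun l => Y l (r l) (r (σ l))).prod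
  have hF : ∑ r : Fin m → Fin n, ((i :: j :: L₀).map fun l =>
      Y' l (r l) (r ((Equiv.swap j (σ j) * σ) l))).prod =
      ∑ r : Fin m → Fin n, ∑ x, F (Function.update r j x) := by
    refine Finset.sum_congr rfl fun r _ => ?_
    have h0 (x : Fin n) : (L₀.map fun l =>
        Y l (Function.update r j x l) (Function.update r j x (σ l))) =
        L₀.map fun l => Y' l (r l) (r ((Equiv.swap j (σ j) * σ) l)) := by
      refine List.map_congr_left fun l hl => ?_
      have hlj : l ≠ j := fun h => hj0 (h ▸ hl)
      have hli : l ≠ i := fun h => hi0 (h ▸ hl)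
      have hσl : σ l ≠ j := fun h => hli (σ.injective (h.trans hj))
      have hσl' : σ l ≠ σ j := fun h => hlj (σ.injective h)
      simp [Y', Function.update_of_ne, hlj, hli, hσl, Equiv.swap_apply_of_ne_of_ne hσl hσl']
    simp only [F, List.map_cons, List.prod_cons, h0, ← hj]
    simp only [← mul_assoc, ← Finset.sum_mul]
    congr 1
    simp [Y', Function.update_of_ne hji.symm, hσj, ← hj, Matrix.mul_apply]
  rw [hF, sum_sum_update, ← Nat.cast_smul_eq_nsmul k] at key
  have := S.smul_mem key (n : k)⁻¹
  rwa [smul_smul, inv_mul_cancel₀ hn, one_smul] at this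

end Contraction

/-! ### Traces of words in `X` and `dX`. -/

section Generators

variable {n : ℕ} {k : Type*} [Field k]

theorem trace_mul_comm_of_commute {R : Type*} [Ring R] (A B : Matrix (Fin n) (Fin n) R)
    (h : ∀ i j p q, Commute (A i j) (B p q)) : (A * B).trace = (B * A).trace := by
  simp only [Matrix.trace, Matrix.diag_apply, Matrix.mul_apply]
  rw [Finset.sum_comm]
  exact Finset.sum_congr rfl fun i _ => Finset.sum_congr rfl fun j _ => h _ _ _ _

/-- The monoid of products of the matrices `X` and `dX`. -/
noncomputable def wordMonoid (n : ℕ) (k : Type*) [Field k] :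
    Submonoid (Matrix (Fin n) (Fin n) (Form n k)) :=
  Submonoid.closure (Set.range (gen n k))

theorem X_mem_wordMonoid : X n k ∈ wordMonoid n k := Submonoid.subset_closure ⟨false, rfl⟩

theorem dX_mem_wordMonoid : dX n k ∈ wordMonoid n k := Submonoid.subset_closure ⟨true, rfl⟩

theorem scalarCommute_of_mem_wordMonoid {A B : Matrix (Fin n) (Fin n) (Form n k)}
    (hA : A ∈ wordMonoid n k) (hB : B ∈ wordMonoid n k) : ScalarCommute k A B := by
  refine ScalarCommute.of_mem_closure ?_ hA hB
  rintro _ ⟨η, rfl⟩ _ ⟨θ, rfl⟩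
  exact ⟨koszulSign k θ η, fun a b p q => gen_mul_gen θ η p q a b⟩

theorem exists_eq_prod_mul_pow {A : Matrix (Fin n) (Fin n) (Form n k)} (hA : A ∈ wordMonoid n k) :
    ∃ (L : List ℕ) (c : ℕ), A = (L.map fun l => X n k ^ l * dX n k).prod * X n k ^ c := by
  refine Submonoid.closure_induction_left (motive := fun A _ => ∃ (L : List ℕ) (c : ℕ),
    A = (L.map fun l => X n k ^ l * dX n k).prod * X n k ^ c) ⟨[], 0, by simp⟩ ?_ hA
  rintro _ ⟨η, rfl⟩ _ _ ⟨L, c, rfl⟩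
  cases η
  · cases L with
    | nil => exact ⟨[], c + 1, by simp [gen, pow_succ']⟩
    | cons l L => exact ⟨(l + 1) :: L, c, by simp [gen, pow_succ', mul_assoc]⟩
  · exact ⟨0 :: L, c, by simp [gen, mul_assoc]⟩

/-- Cyclicity of the trace fails for general matrices of forms, but the entries of `X` are central.
-/
theorem trace_mul_X_pow (A : Matrix (Fin n) (Fin n) (Form n k)) (c : ℕ) :
    (A * X n k ^ c).trace = (X n k ^ c * A).trace := by
  induction c generalizing A with
  | zero => simp
  | succ c ih =>
    rw [pow_succ, ← mul_assoc,
      trace_mul_comm_of_commute (A * X n k ^ c) (X n k) fun i j p q => X_mul_comm p q _,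
      ← mul_assoc, ih, ← mul_assoc]

theorem trace_prod_eq_traceForm (L : List ℕ) :
    (L.map fun l => X n k ^ l * dX n k).prod.trace = traceForm fun i : Fin L.length => L[i] := by
  unfold traceForm
  congr 2
  conv_lhs => rw [← List.ofFn_getElem (xs := L), List.map_ofFn]
  rfl

theorem trace_mem_adjoin {A : Matrix (Fin n) (Fin n) (Form n k)} (hA : A ∈ wordMonoid n k) :
    A.trace ∈ Algebra.adjoin k (generators n k) := by
  obtain ⟨L, c, rfl⟩ := exists_eq_prod_mul_pow hA
  cases L with
  | nil =>
    rw [List.map_nil, List.prod_nil, one_mul]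
    -- The empty word has trace n, a scalar and not one of the listed generators.
    rcases Nat.eq_zero_or_pos c with rfl | hc
    · rw [pow_zero, Matrix.trace_one, Fintype.card_fin]
      exact natCast_mem _ n
    · exact Algebra.subset_adjoin (Or.inl ⟨c, hc, rfl⟩)
  | cons l L =>
    have h : X n k ^ c * ((l :: L).map fun l => X n k ^ l * dX n k).prod =
        (((c + l) :: L).map fun l => X n k ^ l * dX n k).prod := by
      simp [pow_add, mul_assoc]
    rw [trace_mul_X_pow, h, trace_prod_eq_traceForm]
    exact Algebra.subset_adjoin (Or.inr ⟨_, Nat.succ_pos _, _, rfl⟩)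

theorem map_pullback_of_mem_wordMonoid (g : GL (Fin n) k)
    {A : Matrix (Fin n) (Fin n) (Form n k)} (hA : A ∈ wordMonoid n k) :
    A.map (pullback g) = g.val.map (algebraMap k _) * A * g⁻¹.val.map (algebraMap k _) := by
  have hinv : g⁻¹.val.map (algebraMap k (Form n k)) * g.val.map (algebraMap k _) = 1 := by
    rw [← Matrix.map_mul, ← Units.val_mul, inv_mul_cancel, Units.val_one,
      Matrix.map_one _ (map_zero _) (map_one _)]
  have hinv' : g.val.map (algebraMap k (Form n k)) * g⁻¹.val.map (algebraMap k _) = 1 := by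
    rw [← Matrix.map_mul, ← Units.val_mul, mul_inv_cancel, Units.val_one,
      Matrix.map_one _ (map_zero _) (map_one _)]
  refine Submonoid.closure_induction (motive := fun A _ => A.map (pullback g) =
    g.val.map (algebraMap k _) * A * g⁻¹.val.map (algebraMap k _)) ?_ ?_ ?_ hA
  · rintro _ ⟨η, rfl⟩
    ext i j
    simp only [Matrix.map_apply, pullback_gen, Matrix.mul_apply, Finset.sum_mul]
    rw [Finset.sum_comm]
    refine Finset.sum_congr rfl fun q _ => Finset.sum_congr rfl fun p _ => ?_
    rw [← Algebra.commutes, ← mul_assoc, ← map_mul, ← Algebra.smul_def, mul_comm]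
  · rw [mul_one, hinv', Matrix.map_one _ (map_zero _) (map_one _)]
  · intro A B _ _ h1 h2
    rw [Matrix.map_mul, h1, h2]
    simp only [mul_assoc]
    rw [← mul_assoc (g⁻¹.val.map _) (g.val.map _), hinv, one_mul]

theorem trace_mem_invariantForms {A : Matrix (Fin n) (Fin n) (Form n k)}
    (hA : A ∈ wordMonoid n k) : A.trace ∈ invariantForms n k := by
  intro g
  have hinv : g⁻¹.val.map (algebraMap k (Form n k)) * g.val.map (algebraMap k _) = 1 := by
    rw [← Matrix.map_mul, ← Units.val_mul, inv_mul_cancel, Units.val_one,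
      Matrix.map_one _ (map_zero _) (map_one _)]
  have h : pullback g A.trace = (A.map (pullback g)).trace := by
    simp [Matrix.trace, map_sum]
  -- The entries of g are scalars, so g may be rotated around the trace to cancel g⁻¹.
  rw [h, map_pullback_of_mem_wordMonoid g hA, mul_assoc,
    trace_mul_comm_of_commute (g.val.map (algebraMap k (Form n k))) _
      fun i j p q => Algebra.commutes (g.val i j) _, mul_assoc, hinv, mul_one]

theorem generators_subset_invariantForms :
    generators n k ⊆ invariantForms n k := by
  rintro _ (⟨l, -, rfl⟩ | ⟨p, -, l, rfl⟩)
  · exact trace_mem_invariantForms (pow_mem X_mem_wordMonoid l)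
  · refine trace_mem_invariantForms (list_prod_mem fun x hx => ?_)
    obtain ⟨i, rfl⟩ := (List.mem_ofFn' _ _).1 hx
    exact mul_mem (pow_mem X_mem_wordMonoid _) dX_mem_wordMonoid

theorem adjoin_generators [CharZero k] :
    Algebra.adjoin k (generators n k) = invariantForms n k := by
  refine le_antisymm (Algebra.adjoin_le generators_subset_invariantForms) fun u hu => ?_
  have h := invariantForms_le_span (show u ∈ Subalgebra.toSubmodule (invariantForms n k) from hu)
  refine (Submodule.span_le (p := Subalgebra.toSubmodule
    (Algebra.adjoin k (generators n k)))).2 ?_ h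
  rintro _ ⟨m, η, σ, rfl⟩
  rw [SetLike.mem_coe, Subalgebra.mem_toSubmodule]
  -- For n = 0 division by n is impossible, but the contraction is 1 if m = 0 and an empty sum
  -- otherwise.
  rcases Nat.eq_zero_or_pos n with rfl | hn
  · cases m with
    | zero => simp
    | succ m => simp
  · simp only [List.ofFn_eq_map]
    exact contraction_mem _ (wordMonoid n k)
      (fun A hA B hB => scalarCommute_of_mem_wordMonoid hA hB)
      (fun A hA => trace_mem_adjoin hA) (by exact_mod_cast hn.ne') σ (fun i => gen n k (η i))
      (fun i => Submonoid.subset_closure ⟨_, rfl⟩) _ (List.Perm.refl _)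

end Generators

end MatrixForms

theorem mainTheorem1 (k : Type*) [Field k] [CharZero k] (n : ℕ) :
    Algebra.adjoin k (MatrixForms.generators n k) = MatrixForms.invariantForms n k ∧
      ∀ ω : MatrixForms.Form n k, ω ∈ MatrixForms.invariantForms n k ↔
        ω ∈ Submodule.span k
          (Submonoid.closure (MatrixForms.generators n k) : Set (MatrixForms.Form n k)) := by
  refine ⟨MatrixForms.adjoin_generators, fun ω => ?_⟩
  rw [← MatrixForms.adjoin_generators, ← Algebra.adjoin_eq_span, Subalgebra.mem_toSubmodule]
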